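/- Let $M\in\mathbb N$, $D>0$, $k=2\pi/D$. Let $A$ be the real symmetric tridiagonal $(M+1)\times(M+1)$ matrix with rows and columns indexed by $0,\dots,M$, zero diagonal and $A_{i,i+1}=A_{i+1,i}=\sqrt{i+1}$ for $0\le i<M$. Let $H=\mathrm{diag}(h_0,\dots,h_M)$ be real with $h_i\le 0$ for all $i$, $h_0=0$ and $h_M\neq 0$. For $m\in\mathbb Z$ put $A_m=-\mathrm{i}\,mk\,A+H$, and let $\|\cdot\|_2$ be the spectral norm on complex matrices. Then: 1. There is a constant $C$ with $\|\exp(tA_m)\|_2\le C$ for all $m\in\mathbb Z$ and all $t>0$. 2. There is $\lambda^{(0)}>0$ such that for every $m\in\mathbb Z\setminus\{0\}$ all eigenvalues of $A_m$ have real part less than $-\lambda^{(0)}$. For every $m\in\mathbb Z\setminus\{0\}$ there is a decomposition $A_m=R_mJ_mR_m^{-1}$ with $R_m$ invertible, $J_m$ a Jordan normal form (blocks with ones above the diagonal), and every column of $R_m$ that is an eigenvector of $A_m$ a Euclidean unit vector (so if $A_m$ is diagonalizable, every column of $R_m$ is a unit vector). For every family $(R_m,J_m)_{m\ne0}$ of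 such decompositions there is $C^{(0)}>0$ with $\|R_m\|_2\le C^{(0)}$ and $\|R_m^{-1}\|_2\le C^{(0)}$ for all $m\neq0$. 3. For every such family, and all constants $\lambda^{(0)}>0$ and $C^{(0)}>0$ with the properties in 2, for all $m\in\mathbb Z\setminus\{0\}$ and all $t>0$, $$\|\exp(tA_m)\|_2\le (M+1)\,\bigl(C^{(0)}\bigr)^2\,(t^M+1)\,e^{-\lambda^{(0)}t}.$$ -/

import Mathlib

open scoped Matrix Matrix.Norms.L2Operator

namespace HermiteFilter

noncomputable section

/-- The symmetric tridiagonal matrix `A` of size `M + 1` (indices `0, …, M`), with zero diagonal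
and off-diagonal entries `A (i, i + 1) = A (i + 1, i) = √(i + 1)`, as a complex matrix. -/
def advectionMatrix (M : ℕ) : Matrix (Fin (M + 1)) (Fin (M + 1)) ℂ :=
  Matrix.of fun i j =>
    if (i : ℕ) + 1 = j then ((Real.sqrt (j : ℕ) : ℝ) : ℂ)
    else if (j : ℕ) + 1 = i then ((Real.sqrt (i : ℕ) : ℝ) : ℂ)
    else 0

/-- The diagonal matrix `H = diag (h 0, …, h M)` of the filter, as a complex matrix. -/
def filterMatrix {M : ℕ} (h : Fin (M + 1) → ℝ) : Matrix (Fin (M + 1)) (Fin (M + 1)) ℂ :=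
  Matrix.diagonal fun i => (h i : ℂ)

/-- The wave number `k = 2 π / D` of a periodic domain of length `D`. -/
def waveNumber (D : ℝ) : ℝ := 2 * Real.pi / D

/-- The matrix `A_m = - i m k A + H` of the `m`-th Fourier mode. -/
def modeMatrix {M : ℕ} (D : ℝ) (h : Fin (M + 1) → ℝ) (m : ℤ) :
    Matrix (Fin (M + 1)) (Fin (M + 1)) ℂ :=
  (-(Complex.I * (m : ℂ) * (waveNumber D : ℂ))) • advectionMatrix M + filterMatrix h

/-- `J` is a direct sum, along the diagonal, of Jordan blocks (with ones above the diagonal):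
it is upper bidiagonal, every entry just above the diagonal is `0` or `1`, and where it is `1`
the two neighbouring diagonal entries agree. -/
def IsJordanNormalForm {n : ℕ} (J : Matrix (Fin n) (Fin n) ℂ) : Prop :=
  (∀ i j : Fin n, j ≠ i → (j : ℕ) ≠ i + 1 → J i j = 0) ∧
  (∀ i j : Fin n, (j : ℕ) = i + 1 → J i j = 0 ∨ (J i j = 1 ∧ J i i = J j j))

/-- `B = R J R⁻¹` with `J` the Jordan normal form of `B`, the columns of `R` being normalized:
each column that is an eigenvector of `B` is a unit vector for the Euclidean norm. If `B` is
diagonalizable, this means that every column of `R` is a unit vector. -/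
structure IsJordanDecomposition {n : ℕ} (B R J : Matrix (Fin n) (Fin n) ℂ) : Prop where
  jordan : IsJordanNormalForm J
  invertible : IsUnit R
  eq : B = R * J * R⁻¹
  unit_col : ∀ j : Fin n, (∃ μ : ℂ, B *ᵥ R.col j = μ • R.col j) →
    ‖WithLp.toLp 2 (R.col j)‖ = 1

/-- `(R_m, J_m)` is a normalized Jordan decomposition of `A_m`, for every `m ≠ 0`. -/
def IsJordanFamily {M : ℕ} (D : ℝ) (h : Fin (M + 1) → ℝ)
    (R J : ℤ → Matrix (Fin (M + 1)) (Fin (M + 1)) ℂ) : Prop :=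
  ∀ m : ℤ, m ≠ 0 → IsJordanDecomposition (modeMatrix D h m) (R m) (J m)

/-- `C₀ > 0` bounds the spectral norms of `R_m` and of `R_m⁻¹`, for every `m ≠ 0`. -/
def IsTransformBound {n : ℕ} (R : ℤ → Matrix (Fin n) (Fin n) ℂ) (C₀ : ℝ) : Prop :=
  0 < C₀ ∧ ∀ m : ℤ, m ≠ 0 → ‖R m‖ ≤ C₀ ∧ ‖(R m)⁻¹‖ ≤ C₀

/-- `l₀ > 0`, and for every `m ≠ 0` all eigenvalues of `A_m` have real part less than `-l₀`. -/
def IsDecayRate {M : ℕ} (D : ℝ) (h : Fin (M + 1) → ℝ) (l₀ : ℝ) : Prop :=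
  0 < l₀ ∧ ∀ m : ℤ, m ≠ 0 → ∀ μ ∈ spectrum ℂ (modeMatrix D h m), μ.re < -l₀

end

end HermiteFilter

namespace HermiteFilter

/-! ### Eigenvectors of tridiagonal matrices -/

section Tridiagonal

variable {M : ℕ}

/-! Dividing `A_m` by `mk` gives `-iA + εH` with `ε = 1/(mk)`. So all nonzero modes lie in one
family with `|ε| ≤ 1/k`, and their unit eigenvectors in a compact set (`isCompact_unitEigenpairs`).

Decay: the off-diagonal entries do not vanish, so an eigenvector is determined by its last entry.
Hence eigenspaces are lines and `v_M ≠ 0`. As `A` is Hermitian, the eigenvalue of `A_m` has real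
part `∑ h_i |v_i|² ≤ h_M |v_M|² < 0`, with no factor `mk`; compactness makes this uniform.

Transform bound: `A_m` is complex symmetric, so eigenvectors for distinct eigenvalues are orthogonal
for the bilinear form `v ⬝ᵥ w`, and `R⁻¹` is `Rᵀ` with row `i` divided by `r_i ⬝ᵥ r_i`. At `ε = 0`
eigenvectors are real up to a phase and `|v ⬝ᵥ v| = 1`; by compactness `|v ⬝ᵥ v| > 1/2` for large
`|m|`. Only finitely many modes remain.

The exponential then splits into a decaying diagonal factor and a polynomial from the nilpotent
part. -/

theorem advectionMatrix_isHermitian : (advectionMatrix M).IsHermitian := by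
  ext i j
  simp only [advectionMatrix, Matrix.conjTranspose_apply, Matrix.of_apply]
  split_ifs <;> first | omega | simp

theorem advectionMatrix_transpose : (advectionMatrix M)ᵀ = advectionMatrix M := by
  ext i j
  simp only [advectionMatrix, Matrix.transpose_apply, Matrix.of_apply]
  split_ifs <;> first | omega | simp

/-- An eigenvector of `a A + diag g` with vanishing last entry is zero. -/
theorem eq_zero_of_last_eq_zero {a μ : ℂ} (ha : a ≠ 0) {g : Fin (M + 1) → ℝ}
    {v : Fin (M + 1) → ℂ} (hv : (a • advectionMatrix M + filterMatrix g) *ᵥ v = μ • v)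
    (hlast : v (Fin.last M) = 0) : v = 0 := by
  -- Downward induction from the last entry: row `i + 1` of the equation expresses `v i` through
  -- later entries, its coefficient `a √(i + 1)` being nonzero.
  suffices H : ∀ k : ℕ, ∀ i : Fin (M + 1), M ≤ i + k → v i = 0 by
    funext i
    exact H M i (by omega)
  intro k
  induction k with
  | zero =>
    intro i hi
    rw [show i = Fin.last M from Fin.ext (by simp; omega)]
    exact hlast
  | succ k ih =>
    intro i hi
    by_cases hik : M ≤ i + k
    · exact ih i hik
    let p : Fin (M + 1) := ⟨i + 1, by omega⟩
    have hp : (p : ℕ) = i + 1 := rfl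
    have hvp : v p = 0 := ih p (by omega)
    have hrow := congrFun hv p
    have hsum : (advectionMatrix M *ᵥ v) p = ((Real.sqrt (p : ℕ) : ℝ) : ℂ) * v i := by
      rw [Matrix.mulVec, dotProduct, Finset.sum_eq_single i]
      · simp only [advectionMatrix, Matrix.of_apply]
        rw [if_neg (by omega), if_pos hp.symm]
      · intro j _ hj
        have hj' : (j : ℕ) ≠ i := fun h => hj (Fin.ext h)
        by_cases hjp : (j : ℕ) ≤ i
        · have : advectionMatrix M p j = 0 := by
            simp only [advectionMatrix, Matrix.of_apply]
            rw [if_neg (by omega), if_neg (by omega)]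
          rw [this, zero_mul]
        · rw [ih j (by omega), mul_zero]
      · simp
    rw [Matrix.add_mulVec, Matrix.smul_mulVec, Pi.add_apply, Pi.smul_apply, hsum, filterMatrix,
      Matrix.mulVec_diagonal, Pi.smul_apply, hvp] at hrow
    have hs : ((Real.sqrt (p : ℕ) : ℝ) : ℂ) ≠ 0 := by
      rw [Complex.ofReal_ne_zero]
      exact (Real.sqrt_pos.2 (by rw [hp]; positivity)).ne'
    simpa [ha, hs] using hrow

/-- The eigenspaces of `a A + diag g` are at most one-dimensional. -/
theorem exists_eq_smul_of_eigenvector {a μ : ℂ} (ha : a ≠ 0) {g : Fin (M + 1) → ℝ}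
    {v w : Fin (M + 1) → ℂ} (hv : (a • advectionMatrix M + filterMatrix g) *ᵥ v = μ • v)
    (hw : (a • advectionMatrix M + filterMatrix g) *ᵥ w = μ • w) (hv0 : v ≠ 0) :
    ∃ c : ℂ, w = c • v := by
  have hl : v (Fin.last M) ≠ 0 := fun h => hv0 (eq_zero_of_last_eq_zero ha hv h)
  refine ⟨w (Fin.last M) / v (Fin.last M), sub_eq_zero.1 (eq_zero_of_last_eq_zero ha (μ := μ)
    (g := g) ?_ ?_)⟩
  · rw [Matrix.mulVec_sub, Matrix.mulVec_smul, hv, hw, smul_sub, smul_comm]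
  · simp [hl]

theorem ofReal_sum_sq_norm {n : ℕ} (v : Fin n → ℂ) :
    ((‖WithLp.toLp 2 v‖ ^ 2 : ℝ) : ℂ) = star v ⬝ᵥ v := by
  rw [EuclideanSpace.norm_sq_eq]
  simp [dotProduct, Complex.conj_mul']

/-- The real part of an eigenvalue of `a A + diag g`, for imaginary `a`. -/
theorem re_eigenvalue {a μ : ℂ} (ha : a.re = 0) {g : Fin (M + 1) → ℝ}
    {v : Fin (M + 1) → ℂ} (hv : (a • advectionMatrix M + filterMatrix g) *ᵥ v = μ • v)
    (hnorm : ‖WithLp.toLp 2 v‖ = 1) : μ.re = ∑ i, g i * ‖v i‖ ^ 2 := by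
  have h1 : star v ⬝ᵥ v = 1 := by rw [← ofReal_sum_sq_norm, hnorm]; simp
  have h2 := congrArg (fun w => star v ⬝ᵥ w) hv
  simp only [Matrix.add_mulVec, Matrix.smul_mulVec, dotProduct_add, dotProduct_smul, h1,
    smul_eq_mul, mul_one] at h2
  have h3 : (star v ⬝ᵥ (advectionMatrix M *ᵥ v)).im = 0 :=
    advectionMatrix_isHermitian.im_star_dotProduct_mulVec_self v
  rw [← h2, Complex.add_re, Complex.mul_re, ha, h3, zero_mul, mul_zero, sub_zero, zero_add]
  simp only [dotProduct, filterMatrix, Matrix.mulVec_diagonal, Complex.re_sum]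
  refine Finset.sum_congr rfl fun i _ => ?_
  rw [mul_left_comm, Pi.star_apply, RCLike.star_def, Complex.conj_mul']
  norm_cast

/-- A unit eigenvector of `-i A` is a unimodular multiple of a real vector. -/
theorem norm_dotProduct_self_of_eigenvector {μ : ℂ} {v : Fin (M + 1) → ℂ}
    (hv : ((-Complex.I) • advectionMatrix M + filterMatrix 0) *ᵥ v = μ • v)
    (hnorm : ‖WithLp.toLp 2 v‖ = 1) : ‖v ⬝ᵥ v‖ = 1 := by
  have hI : -Complex.I ≠ 0 := neg_ne_zero.2 Complex.I_ne_zero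
  have h1 : star v ⬝ᵥ v = 1 := by rw [← ofReal_sum_sq_norm, hnorm]; simp
  have hv0 : v ≠ 0 := by rintro rfl; simp at h1
  have hre : μ.re = 0 := by simp [re_eigenvalue (by simp) hv hnorm]
  have hH : filterMatrix (0 : Fin (M + 1) → ℝ) = 0 := by
    ext i j; simp [filterMatrix]
  -- `μ` is imaginary, so conjugation negates both `-iA` and `μ`: `star v` is an eigenvector for the
  -- same `μ`. Thus `star v = c • v` with `‖c‖ = 1`, and `1 = star v ⬝ᵥ v = c * (v ⬝ᵥ v)`.
  have hs : ((-Complex.I) • advectionMatrix M + filterMatrix 0) *ᵥ star v = μ • star v := by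
    rw [hH, add_zero] at hv ⊢
    have h3 := congrArg star hv
    rw [Matrix.star_mulVec, Matrix.conjTranspose_smul, advectionMatrix_isHermitian.eq,
      ← Matrix.mulVec_transpose, Matrix.transpose_smul, advectionMatrix_transpose, star_smul,
      star_neg] at h3
    have h4 : star μ = -μ := by
      apply Complex.ext <;> simp [hre]
    rw [h4, Matrix.smul_mulVec] at h3
    rw [Matrix.smul_mulVec, neg_smul]
    simp only [RCLike.star_def, Complex.conj_I, neg_neg, neg_smul] at h3
    rw [h3, neg_neg]
  obtain ⟨c, hc⟩ := exists_eq_smul_of_eigenvector hI hv hs hv0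
  have h5 : star v ⬝ᵥ v = c * (v ⬝ᵥ v) := by rw [hc, smul_dotProduct, smul_eq_mul]
  have h6 : ‖WithLp.toLp 2 (star v)‖ = 1 := by
    rw [← hnorm, EuclideanSpace.norm_eq, EuclideanSpace.norm_eq]
    simp
  rw [hc, WithLp.toLp_smul, norm_smul, hnorm, mul_one] at h6
  rw [← one_mul ‖v ⬝ᵥ v‖, ← h6, ← norm_mul, ← h5, h1, norm_one, h6]

theorem exists_unit_eigenvector {n : ℕ} {B : Matrix (Fin n) (Fin n) ℂ} {μ : ℂ}
    (hμ : μ ∈ spectrum ℂ B) :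
    ∃ v : EuclideanSpace ℂ (Fin n), ‖v‖ = 1 ∧ B *ᵥ v.ofLp = μ • v.ofLp := by
  rw [← Matrix.spectrum_toLin', ← Module.End.hasEigenvalue_iff_mem_spectrum] at hμ
  obtain ⟨v, hv⟩ := hμ.exists_hasEigenvector
  have hv0 : ‖WithLp.toLp 2 v‖ ≠ 0 := by simpa using hv.2
  have hv1 : B *ᵥ v = μ • v := by simpa using hv.apply_eq_smul
  refine ⟨(((‖WithLp.toLp 2 v‖⁻¹ : ℝ) : ℂ)) • WithLp.toLp 2 v, ?_, ?_⟩
  · rw [norm_smul, Complex.norm_real, norm_inv, norm_norm, inv_mul_cancel₀ hv0]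
  · rw [WithLp.ofLp_smul, Matrix.mulVec_smul, hv1, smul_comm]

end Tridiagonal

/-! ### Uniform estimates for unit eigenvectors -/

section Compactness

variable {M : ℕ}

/-- The matrix `-i A + ε H`, which is `A_m / (m k)` for `ε = 1 / (m k)`. -/
noncomputable def scaledMatrix (h : Fin (M + 1) → ℝ) (ε : ℝ) :
    Matrix (Fin (M + 1)) (Fin (M + 1)) ℂ :=
  (-Complex.I) • advectionMatrix M + filterMatrix (ε • h)

/-- The triples `(ε, μ, v)` with `v` a unit eigenvector of `-i A + ε H` for `μ`, and `|ε| ≤ r`. -/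
def unitEigenpairs (h : Fin (M + 1) → ℝ) (r : ℝ) :
    Set (ℝ × ℂ × EuclideanSpace ℂ (Fin (M + 1))) :=
  {p | |p.1| ≤ r ∧ ‖p.2.2‖ = 1 ∧ scaledMatrix h p.1 *ᵥ p.2.2.ofLp = p.2.1 • p.2.2.ofLp}

theorem continuous_scaledMatrix (h : Fin (M + 1) → ℝ) : Continuous (scaledMatrix h) := by
  unfold scaledMatrix filterMatrix
  refine continuous_const.add (Continuous.matrix_diagonal ?_)
  refine continuous_pi fun i => Complex.continuous_ofReal.comp ?_
  simp only [Pi.smul_apply, smul_eq_mul]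
  fun_prop

/-- The conditions are closed, and an eigenvalue is at most the spectral norm of its matrix, which
is bounded for `|ε| ≤ r`. -/
theorem isCompact_unitEigenpairs (h : Fin (M + 1) → ℝ) (r : ℝ) :
    IsCompact (unitEigenpairs h r) := by
  obtain ⟨C, hC⟩ := (isCompact_Icc (a := -r) (b := r)).exists_bound_of_continuousOn
    (continuous_scaledMatrix h).continuousOn
  have hK : IsCompact (Set.Icc (-r) r ×ˢ (Metric.closedBall (0 : ℂ) C ×ˢ
      Metric.closedBall (0 : EuclideanSpace ℂ (Fin (M + 1))) 1)) :=
    isCompact_Icc.prod ((isCompact_closedBall _ _).prod (isCompact_closedBall _ _))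
  refine hK.of_isClosed_subset ?_ ?_
  · have h1 : IsClosed {p : ℝ × ℂ × EuclideanSpace ℂ (Fin (M + 1)) | |p.1| ≤ r} :=
      isClosed_le (by fun_prop) continuous_const
    have h2 : IsClosed {p : ℝ × ℂ × EuclideanSpace ℂ (Fin (M + 1)) | ‖p.2.2‖ = 1} :=
      isClosed_eq (by fun_prop) continuous_const
    have h3 : IsClosed {p : ℝ × ℂ × EuclideanSpace ℂ (Fin (M + 1)) |
        scaledMatrix h p.1 *ᵥ p.2.2.ofLp = p.2.1 • p.2.2.ofLp} :=
      isClosed_eq (((continuous_scaledMatrix h).comp continuous_fst).matrix_mulVec (by fun_prop))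
        (by fun_prop)
    exact h1.inter (h2.inter h3)
  · rintro ⟨ε, μ, v⟩ ⟨hε, hv, he⟩
    have hε' : ε ∈ Set.Icc (-r) r := abs_le.1 hε
    refine ⟨hε', ?_, by simpa using hv.le⟩
    have h1 := Matrix.l2_opNorm_mulVec (scaledMatrix h ε) v
    dsimp only at he hv
    have h2 : (WithLp.toLp 2 (scaledMatrix h ε *ᵥ v.ofLp)) = μ • v := by rw [he]; rfl
    have h3 : ‖μ • v‖ ≤ ‖scaledMatrix h ε‖ * ‖v‖ := by rw [← h2]; exact h1
    rw [norm_smul, hv, mul_one, mul_one] at h3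
    simpa using h3.trans (hC ε hε')

/-- The dissipation of unit eigenvectors of `-i A + ε H` is bounded below. -/
theorem exists_dissipation_bound {h : Fin (M + 1) → ℝ} (h_nonpos : ∀ i, h i ≤ 0)
    (h_last : h (Fin.last M) ≠ 0) (r : ℝ) :
    ∃ δ : ℝ, 0 < δ ∧ ∀ p ∈ unitEigenpairs h r, ∑ i, h i * ‖p.2.2 i‖ ^ 2 ≤ -δ := by
  have hpos : ∀ p ∈ unitEigenpairs h r, 0 < -∑ i, h i * ‖p.2.2 i‖ ^ 2 := by
    rintro ⟨ε, μ, v⟩ ⟨-, hv, he⟩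
    dsimp only at hv he ⊢
    rw [← Finset.sum_neg_distrib]
    have hnn : ∀ i, 0 ≤ -(h i * ‖v i‖ ^ 2) := fun i =>
      neg_nonneg.2 (mul_nonpos_of_nonpos_of_nonneg (h_nonpos i) (by positivity))
    refine Finset.sum_pos' (fun i _ => hnn i) ⟨Fin.last M, Finset.mem_univ _, ?_⟩
    refine lt_of_le_of_ne (hnn _) fun h0 => ?_
    have hl : v (Fin.last M) = 0 := by
      have h1 := h0.symm
      simpa [h_last] using h1
    have h2 := eq_zero_of_last_eq_zero (neg_ne_zero.2 Complex.I_ne_zero) he hl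
    have h3 : v = 0 := WithLp.ofLp_injective 2 h2
    simp [h3] at hv
  obtain ⟨δ, hδ, hle⟩ := (isCompact_unitEigenpairs h r).exists_forall_le' (by fun_prop) hpos
  exact ⟨δ, hδ, fun p hp => le_neg_of_le_neg (hle p hp)⟩

/-- For small `ε`, unit eigenvectors of `-i A + ε H` are far from isotropic. -/
theorem exists_half_lt_norm_dotProduct_self (h : Fin (M + 1) → ℝ) :
    ∃ ρ : ℝ, 0 < ρ ∧ ∀ (ε : ℝ) (μ : ℂ) (v : Fin (M + 1) → ℂ), |ε| < ρ →
      ‖WithLp.toLp 2 v‖ = 1 → scaledMatrix h ε *ᵥ v = μ • v → 1 / 2 < ‖v ⬝ᵥ v‖ := by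
  have hclosed : IsClosed {p : ℝ × ℂ × EuclideanSpace ℂ (Fin (M + 1)) |
      ‖p.2.2.ofLp ⬝ᵥ p.2.2.ofLp‖ ≤ 1 / 2} :=
    isClosed_le (by unfold dotProduct; fun_prop) continuous_const
  -- The bad `ε` form the projection of a compact set, hence a closed set; it misses `0`, hence a
  -- ball around `0`.
  have hP := (((isCompact_unitEigenpairs h 1).inter_right hclosed).image continuous_fst).isClosed
  have h0 : (0 : ℝ) ∈ (Prod.fst '' (unitEigenpairs h 1 ∩ {p | ‖p.2.2.ofLp ⬝ᵥ p.2.2.ofLp‖ ≤ 1 / 2}))ᶜ := by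
    rintro ⟨⟨ε, μ, v⟩, ⟨⟨-, hv, he⟩, hle⟩, hε⟩
    dsimp only at hv he hε
    subst hε
    rw [scaledMatrix, zero_smul] at he
    have h1 := norm_dotProduct_self_of_eigenvector he hv
    have h2 : ‖v.ofLp ⬝ᵥ v.ofLp‖ ≤ 1 / 2 := hle
    linarith
  obtain ⟨ρ, hρ, hball⟩ := Metric.isOpen_iff.1 hP.isOpen_compl 0 h0
  refine ⟨min ρ 1, by positivity, fun ε μ v hε hv he => ?_⟩
  by_contra! hcon
  refine hball (a := ε) (by simpa using hε.trans_le (min_le_left _ _)) ?_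
  exact ⟨⟨ε, μ, WithLp.toLp 2 v⟩, ⟨⟨(hε.trans_le (min_le_right _ _)).le, hv, he⟩, hcon⟩, rfl⟩

variable {D : ℝ} {h : Fin (M + 1) → ℝ} {m : ℤ}

theorem waveNumber_pos (hD : 0 < D) : 0 < waveNumber D := by
  unfold waveNumber
  positivity

theorem modeMatrix_eq_smul (hD : 0 < D) (hm : m ≠ 0) :
    modeMatrix D h m = ((m * waveNumber D : ℝ) : ℂ) • scaledMatrix h (m * waveNumber D)⁻¹ := by
  have hk := (waveNumber_pos hD).ne'
  have hm' : (m : ℂ) ≠ 0 := by exact_mod_cast hm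
  have hk' : (waveNumber D : ℂ) ≠ 0 := by exact_mod_cast hk
  ext i j
  simp only [modeMatrix, scaledMatrix, filterMatrix, Matrix.add_apply, Matrix.smul_apply,
    Matrix.diagonal_apply, smul_eq_mul, Pi.smul_apply]
  split_ifs
  · push_cast
    field_simp
  · push_cast
    ring

theorem scaledMatrix_mulVec_of_eigenvector (hD : 0 < D) (hm : m ≠ 0) {μ : ℂ}
    {v : Fin (M + 1) → ℂ} (hv : modeMatrix D h m *ᵥ v = μ • v) :
    scaledMatrix h (m * waveNumber D)⁻¹ *ᵥ v = (μ / ((m * waveNumber D : ℝ) : ℂ)) • v := by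
  have hc : ((m * waveNumber D : ℝ) : ℂ) ≠ 0 := by
    have := (waveNumber_pos hD).ne'
    have hm' : (m : ℝ) ≠ 0 := by exact_mod_cast hm
    exact_mod_cast mul_ne_zero hm' this
  rw [modeMatrix_eq_smul hD hm, Matrix.smul_mulVec] at hv
  rw [div_eq_inv_mul, mul_smul, ← hv, smul_smul, inv_mul_cancel₀ hc, one_smul]

theorem abs_inv_mul_waveNumber_le (hD : 0 < D) (hm : m ≠ 0) :
    |((m : ℝ) * waveNumber D)⁻¹| ≤ (waveNumber D)⁻¹ := by
  have hk := waveNumber_pos hD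
  have h1 : (1 : ℝ) ≤ |(m : ℝ)| := by exact_mod_cast Int.one_le_abs hm
  rw [abs_inv, abs_mul, abs_of_pos hk]
  exact inv_anti₀ hk (le_mul_of_one_le_left hk.le h1)

theorem mode_coeff_re : (-(Complex.I * (m : ℂ) * (waveNumber D : ℂ))).re = 0 := by
  simp

theorem mode_coeff_ne_zero (hD : 0 < D) (hm : m ≠ 0) :
    -(Complex.I * (m : ℂ) * (waveNumber D : ℂ)) ≠ 0 := by
  have hk := (waveNumber_pos hD).ne'
  simp [hm, hk]

theorem exists_isDecayRate (hD : 0 < D) (h_nonpos : ∀ i, h i ≤ 0) (h_last : h (Fin.last M) ≠ 0) :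
    ∃ l₀ : ℝ, IsDecayRate D h l₀ := by
  obtain ⟨δ, hδ, hle⟩ := exists_dissipation_bound h_nonpos h_last (waveNumber D)⁻¹
  -- Halving `δ` makes the inequality strict.
  refine ⟨δ / 2, by positivity, fun m hm μ hμ => ?_⟩
  obtain ⟨v, hv, he⟩ := exists_unit_eigenvector hμ
  rw [re_eigenvalue mode_coeff_re he hv]
  have := hle ⟨_, _, v⟩ ⟨abs_inv_mul_waveNumber_le hD hm, hv,
    scaledMatrix_mulVec_of_eigenvector hD hm he⟩
  dsimp only at this
  linarith

end Compactness

/-! ### Jordan decompositions of symmetric matrices and transform bounds -/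

section Transform

section General

variable {n : ℕ} {B R J : Matrix (Fin n) (Fin n) ℂ}

theorem IsJordanDecomposition.mul_eq (H : IsJordanDecomposition B R J) : B * R = R * J := by
  have hdet : IsUnit R.det := (Matrix.isUnit_iff_isUnit_det R).1 H.invertible
  rw [H.eq, Matrix.mul_assoc, Matrix.nonsing_inv_mul _ hdet, Matrix.mul_one]

theorem IsJordanDecomposition.mulVec_col (H : IsJordanDecomposition B R J) (j : Fin n) :
    B *ᵥ R.col j = ∑ i, J i j • R.col i := by
  funext l
  have h1 := congrFun (congrFun H.mul_eq l) j
  rw [Matrix.mul_apply, Matrix.mul_apply] at h1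
  simp only [Matrix.mulVec, dotProduct, Finset.sum_apply, Pi.smul_apply, smul_eq_mul, Matrix.col_apply]
  rw [h1]
  exact Finset.sum_congr rfl fun i _ => mul_comm _ _

/-- A column of `R` which starts a Jordan block is an eigenvector. -/
theorem IsJordanDecomposition.mulVec_col_of_first (H : IsJordanDecomposition B R J) {j : Fin n}
    (hj : ∀ i : Fin n, (j : ℕ) = i + 1 → J i j = 0) : B *ᵥ R.col j = J j j • R.col j := by
  rw [H.mulVec_col, Finset.sum_eq_single j]
  · intro i _ hij
    by_cases h1 : (j : ℕ) = i + 1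
    · rw [hj i h1, zero_smul]
    · rw [H.jordan.1 i j hij.symm h1, zero_smul]
  · simp

theorem IsJordanDecomposition.mulVec_col_succ (H : IsJordanDecomposition B R J) {i j : Fin n}
    (hij : (j : ℕ) = i + 1) : B *ᵥ R.col j = J j j • R.col j + J i j • R.col i := by
  have hne : j ≠ i := fun h => by subst h; omega
  rw [H.mulVec_col, Finset.sum_eq_add j i hne]
  · rintro l - ⟨h1, h2⟩
    rw [H.jordan.1 l j h1.symm fun h => h2 (Fin.ext (by omega)), zero_smul]
  · simp
  · simp

theorem IsJordanDecomposition.linearIndependent_col (H : IsJordanDecomposition B R J) :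
    LinearIndependent ℂ R.col :=
  Matrix.linearIndependent_cols_iff_isUnit.2 H.invertible

theorem dotProduct_mulVec_comm_of_symm (hB : Bᵀ = B) (v w : Fin n → ℂ) :
    v ⬝ᵥ (B *ᵥ w) = (B *ᵥ v) ⬝ᵥ w := by
  rw [Matrix.dotProduct_mulVec, ← Matrix.mulVec_transpose, hB]

/-- The Jordan form of a symmetric matrix without isotropic eigenvectors is diagonal. -/
theorem IsJordanDecomposition.superdiagonal_eq_zero (H : IsJordanDecomposition B R J)
    (hB : Bᵀ = B) (hiso : ∀ (μ : ℂ) (v : Fin n → ℂ), ‖WithLp.toLp 2 v‖ = 1 → B *ᵥ v = μ • v →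
      v ⬝ᵥ v ≠ 0) : ∀ i j : Fin n, (j : ℕ) = i + 1 → J i j = 0 := by
  suffices hk : ∀ k : ℕ, ∀ i j : Fin n, (i : ℕ) = k → (j : ℕ) = i + 1 → J i j = 0 from
    fun i j => hk i i j rfl
  intro k
  induction k using Nat.strong_induction_on with
  | _ k ih =>
  intro i j hi hij
  rcases H.jordan.2 i j hij with h0 | ⟨h1, hd⟩
  · exact h0
  -- By induction column `i` starts its block. If `J i j = 1`, pairing `B r_j = λ r_j + r_i` with
  -- `r_i` gives `r_i ⬝ᵥ r_i = 0`.
  have hi1 := H.mulVec_col_of_first (j := i) fun l hl => ih l (by omega) l i rfl hl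
  have hj := H.mulVec_col_succ hij
  have hne := hiso _ _ (H.unit_col i ⟨_, hi1⟩) hi1
  have hs := dotProduct_mulVec_comm_of_symm hB (R.col i) (R.col j)
  rw [hi1, hj, dotProduct_add, dotProduct_smul, dotProduct_smul, smul_dotProduct, h1, hd,
    one_smul, add_eq_left] at hs
  exact absurd hs hne

/-- If a symmetric matrix has simple eigenvalues, then `R⁻¹` is a row scaling of `Rᵀ`. -/
theorem IsJordanDecomposition.inv_eq (H : IsJordanDecomposition B R J) (hB : Bᵀ = B)
    (hiso : ∀ (μ : ℂ) (v : Fin n → ℂ), ‖WithLp.toLp 2 v‖ = 1 → B *ᵥ v = μ • v → v ⬝ᵥ v ≠ 0)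
    (hsimple : ∀ (μ : ℂ) (v w : Fin n → ℂ), v ≠ 0 → B *ᵥ v = μ • v → B *ᵥ w = μ • w →
      ∃ c : ℂ, w = c • v) :
    R⁻¹ = Matrix.diagonal (fun i => (R.col i ⬝ᵥ R.col i)⁻¹) * Rᵀ := by
  have hsup := H.superdiagonal_eq_zero hB hiso
  have heig : ∀ j, B *ᵥ R.col j = J j j • R.col j := fun j =>
    H.mulVec_col_of_first fun i hi => hsup i j hi
  refine Matrix.inv_eq_left_inv ?_
  ext i j
  rw [Matrix.mul_assoc, Matrix.diagonal_mul]
  change (R.col i ⬝ᵥ R.col i)⁻¹ * (R.col i ⬝ᵥ R.col j) = _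
  by_cases hij : i = j
  · subst hij
    rw [Matrix.one_apply_eq, inv_mul_cancel₀ (hiso _ _ (H.unit_col i ⟨_, heig i⟩) (heig i))]
  · rw [Matrix.one_apply_ne hij]
    -- Distinct eigenvalues force orthogonality; equal ones would make the two columns proportional.
    have hs := dotProduct_mulVec_comm_of_symm hB (R.col i) (R.col j)
    rw [heig i, heig j, dotProduct_smul, smul_dotProduct] at hs
    by_cases hJ : J i i = J j j
    · obtain ⟨c, hc⟩ := hsimple (J i i) _ (R.col j) (H.linearIndependent_col.ne_zero i) (heig i)
        (by rw [hJ]; exact heig j)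
      refine absurd ?_ (H.linearIndependent_col.notMem_span_image (s := {i}) (x := j)
        fun h => hij (Set.mem_singleton_iff.1 h).symm)
      rw [Set.image_singleton, hc]
      exact Submodule.smul_mem _ _ (Submodule.mem_span_singleton_self _)
    · have : (J j j - J i i) * (R.col i ⬝ᵥ R.col j) = 0 := by
        rw [sub_mul, sub_eq_zero]; exact hs
      rw [(mul_eq_zero.1 this).resolve_left (sub_ne_zero.2 (Ne.symm hJ)), mul_zero]

theorem exists_norm_le_of_entries (n : ℕ) (c : ℝ) :
    ∃ K : ℝ, ∀ X : Matrix (Fin n) (Fin n) ℂ, (∀ i j, ‖X i j‖ ≤ c) → ‖X‖ ≤ K := by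
  have hK : IsCompact (Set.univ.pi fun _ : Fin n => Set.univ.pi fun _ : Fin n =>
      Metric.closedBall (0 : ℂ) c) :=
    isCompact_univ_pi fun _ => isCompact_univ_pi fun _ => isCompact_closedBall _ _
  have hc : Continuous fun X : Matrix (Fin n) (Fin n) ℂ => X := continuous_id
  obtain ⟨K, hK⟩ := IsCompact.exists_bound_of_continuousOn (E := Matrix (Fin n) (Fin n) ℂ) hK
    hc.continuousOn
  exact ⟨K, fun X hX => hK X fun i _ j _ => by simpa using hX i j⟩

end General

variable {M : ℕ} {D : ℝ} {h : Fin (M + 1) → ℝ} {m : ℤ}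

theorem modeMatrix_transpose : (modeMatrix D h m)ᵀ = modeMatrix D h m := by
  rw [modeMatrix, Matrix.transpose_add, Matrix.transpose_smul, advectionMatrix_transpose,
    filterMatrix, Matrix.diagonal_transpose]

theorem exists_isTransformBound (hD : 0 < D)
    {R J : ℤ → Matrix (Fin (M + 1)) (Fin (M + 1)) ℂ} (H : IsJordanFamily D h R J) :
    ∃ C₀ : ℝ, IsTransformBound R C₀ := by
  obtain ⟨ρ, hρ, hhalf⟩ := exists_half_lt_norm_dotProduct_self h
  -- Entries of `R` are at most `1`; those of `R⁻¹` at most `2`, from `|v ⬝ᵥ v| > 1/2`.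
  obtain ⟨K, hK⟩ := exists_norm_le_of_entries (M + 1) 2
  have hk := waveNumber_pos hD
  obtain ⟨N, hN⟩ := exists_nat_gt (waveNumber D * ρ)⁻¹
  have hlarge : ∀ m : ℤ, (N : ℤ) < |m| → ‖R m‖ ≤ K ∧ ‖(R m)⁻¹‖ ≤ K := by
    intro m hmN
    have hm : m ≠ 0 := by
      rintro rfl
      simp at hmN
      omega
    have Hm := H m hm
    have hε : |((m : ℝ) * waveNumber D)⁻¹| < ρ := by
      have h1 : (N : ℝ) < |(m : ℝ)| := by exact_mod_cast hmN
      have h2 : 0 < |(m : ℝ)| := (Nat.cast_nonneg N).trans_lt h1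
      rw [abs_inv, abs_mul, abs_of_pos hk]
      rw [inv_lt_comm₀ (by positivity) hρ]
      have h3 := hN.trans h1
      rw [mul_inv, inv_mul_lt_iff₀ hk] at h3
      linarith
    have hd : ∀ (μ : ℂ) (v : Fin (M + 1) → ℂ), ‖WithLp.toLp 2 v‖ = 1 →
        modeMatrix D h m *ᵥ v = μ • v → 1 / 2 < ‖v ⬝ᵥ v‖ := fun μ v hv he =>
      hhalf _ _ v hε hv (scaledMatrix_mulVec_of_eigenvector hD hm he)
    have hiso : ∀ (μ : ℂ) (v : Fin (M + 1) → ℂ), ‖WithLp.toLp 2 v‖ = 1 →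
        modeMatrix D h m *ᵥ v = μ • v → v ⬝ᵥ v ≠ 0 := fun μ v hv he h0 => by
      have := hd μ v hv he
      rw [h0, norm_zero] at this
      linarith
    have hsup := Hm.superdiagonal_eq_zero modeMatrix_transpose hiso
    have heig : ∀ j, modeMatrix D h m *ᵥ (R m).col j = J m j j • (R m).col j := fun j =>
      Hm.mulVec_col_of_first fun i hi => hsup i j hi
    have hunit := fun j => Hm.unit_col j ⟨_, heig j⟩
    have hentry : ∀ i j, ‖R m i j‖ ≤ 1 := fun i j => by
      rw [← hunit j]
      exact PiLp.norm_apply_le (WithLp.toLp 2 ((R m).col j)) i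
    refine ⟨hK _ fun i j => (hentry i j).trans one_le_two, hK _ fun i j => ?_⟩
    rw [Hm.inv_eq modeMatrix_transpose hiso fun μ v w hv0 hv hw =>
      exists_eq_smul_of_eigenvector (mode_coeff_ne_zero hD hm) hv hw hv0]
    rw [Matrix.diagonal_mul, norm_mul, norm_inv, Matrix.transpose_apply]
    have h1 := hd _ _ (hunit i) (heig i)
    have h2 : ‖(R m).col i ⬝ᵥ (R m).col i‖⁻¹ ≤ 2 := by
      rw [inv_le_comm₀ (by linarith) two_pos]
      linarith
    calc _ ≤ 2 * 1 := mul_le_mul h2 (hentry j i) (norm_nonneg _) two_pos.le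
      _ = 2 := mul_one 2
  -- For the finitely many other modes, where nontrivial Jordan blocks may occur, no estimate is
  -- needed: their norms are summed.
  let s := Finset.Icc (-(N : ℤ)) N
  have hsum : 0 ≤ ∑ m ∈ s, (‖R m‖ + ‖(R m)⁻¹‖) := Finset.sum_nonneg fun _ _ => by positivity
  refine ⟨|K| + ∑ m ∈ s, (‖R m‖ + ‖(R m)⁻¹‖) + 1, by positivity, fun m _ => ?_⟩
  by_cases hmN : (N : ℤ) < |m|
  · have h1 := hlarge m hmN
    have h2 := le_abs_self K
    constructor <;> linarith
  · have hms : m ∈ s := Finset.mem_Icc.2 (abs_le.1 (not_lt.1 hmN))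
    have h1 := Finset.single_le_sum (f := fun m => ‖R m‖ + ‖(R m)⁻¹‖)
      (fun _ _ => by positivity) hms
    have h2 := abs_nonneg K
    have h3 := norm_nonneg (R m)
    have h4 := norm_nonneg (R m)⁻¹
    constructor <;> linarith

end Transform

/-! ### Jordan normal form of operators with one-dimensional eigenspaces -/

section JordanBasis

open Module

/-- A nilpotent operator with at most one-dimensional kernel has a basis which is a chain. -/
theorem exists_chain_basis {E : Type*} [NormedAddCommGroup E] [NormedSpace ℂ E] (N : End ℂ E)
    (hN : IsNilpotent N)
    (hker : ∀ x y, N x = 0 → N y = 0 → x ≠ 0 → ∃ c : ℂ, y = c • x) :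
    ∃ (d : ℕ) (b : Basis (Fin d) ℂ E), (∀ j : Fin d, (j : ℕ) = 0 → N (b j) = 0 ∧ ‖b j‖ = 1) ∧
      ∀ i j : Fin d, (j : ℕ) = i + 1 → N (b j) = b i := by
  classical
  obtain ⟨d, hd, hmin⟩ : ∃ d, N ^ d = 0 ∧ ∀ l < d, N ^ l ≠ 0 :=
    ⟨Nat.find hN, Nat.find_spec hN, fun l hl => Nat.find_min hN hl⟩
  -- The chain is generated by `x`, scaled so that its eigenvector `N ^ (d - 1) x` is a unit vector.
  -- If `d = 0` the space is trivial.
  obtain ⟨x, hx⟩ : ∃ x : E, 0 < d → ‖(N ^ (d - 1)) x‖ = 1 := by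
    by_cases h0 : 0 < d
    · obtain ⟨x, hx⟩ : ∃ x, (N ^ (d - 1)) x ≠ 0 := by
        by_contra! hcon
        exact hmin (d - 1) (by omega) (LinearMap.ext hcon)
      refine ⟨((‖(N ^ (d - 1)) x‖⁻¹ : ℝ) : ℂ) • x, fun _ => ?_⟩
      rw [map_smul, norm_smul, Complex.norm_real, norm_inv, norm_norm,
        inv_mul_cancel₀ (norm_ne_zero_iff.2 hx)]
    · exact ⟨0, fun h => absurd h h0⟩
  have hadd : ∀ a b, (N ^ a) ((N ^ b) x) = (N ^ (a + b)) x := fun a b => by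
    rw [pow_add, Module.End.mul_apply]
  have hzero : ∀ a, d ≤ a → (N ^ a) x = 0 := fun a ha => by
    rw [pow_eq_zero_of_le ha hd, LinearMap.zero_apply]
  let v : Fin d → E := fun j => (N ^ (d - 1 - j)) x
  have hli : LinearIndependent ℂ v := by
    rw [Fintype.linearIndependent_iff]
    intro g hg
    -- Applying `N ^ j` kills the terms below `j`; those above `j` vanish by induction.
    suffices hk : ∀ k : ℕ, ∀ j : Fin d, d ≤ j + k → g j = 0 from fun j => hk d j (by omega)
    intro k
    induction k with
    | zero => intro j hj; omega
    | succ k ih =>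
      intro j hj
      have h1 := congrArg (N ^ (j : ℕ)) hg
      rw [map_sum, map_zero, Finset.sum_eq_single j] at h1
      · rw [map_smul, hadd, show (j : ℕ) + (d - 1 - j) = d - 1 by omega] at h1
        refine (smul_eq_zero.1 h1).resolve_right (norm_ne_zero_iff.1 ?_)
        rw [hx (by omega)]
        exact one_ne_zero
      · intro l _ hl
        have hl' : (l : ℕ) ≠ j := fun h => hl (Fin.ext h)
        by_cases hlj : (l : ℕ) < j
        · rw [map_smul, hadd, hzero _ (by omega), smul_zero]
        · rw [ih l (by omega), zero_smul, map_zero]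
      · simp
  have hspan : ∀ l ≤ d, ∀ y, (N ^ l) y = 0 → y ∈ Submodule.span ℂ (Set.range v) := by
    intro l
    induction l with
    | zero =>
      intro _ y hy
      rw [pow_zero, Module.End.one_apply] at hy
      rw [hy]
      exact Submodule.zero_mem _
    | succ l ih =>
      intro hl y hy
      -- `N ^ l y` lies in the kernel, a line spanned by `N ^ (d - 1) x = N ^ l (v l)`; subtracting
      -- a multiple of `v l` lowers `l`.
      obtain ⟨c, hc⟩ := hker ((N ^ (d - 1)) x) ((N ^ l) y)
        (by rw [← Module.End.mul_apply, ← pow_succ', ← hzero d le_rfl, Nat.sub_add_cancel (by omega)])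
        (by rw [← Module.End.mul_apply, ← pow_succ', hy])
        (norm_ne_zero_iff.1 (by rw [hx (by omega)]; exact one_ne_zero))
      have h1 : v ⟨l, hl⟩ ∈ Submodule.span ℂ (Set.range v) := Submodule.subset_span ⟨_, rfl⟩
      rw [← sub_add_cancel y (c • v ⟨l, hl⟩)]
      refine Submodule.add_mem _ (ih (by omega) _ ?_) (Submodule.smul_mem _ _ h1)
      rw [map_sub, map_smul, hc, hadd, show l + (d - 1 - l) = d - 1 by omega, sub_self]
  refine ⟨d, Basis.mk hli fun y _ => hspan d le_rfl y (by rw [hd, LinearMap.zero_apply]), ?_, ?_⟩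
  · intro j hj
    rw [Basis.mk_apply]
    simp only [v, hj, Nat.sub_zero]
    refine ⟨?_, hx (by omega)⟩
    rw [← Module.End.mul_apply, ← pow_succ', hzero _ (by omega)]
  · intro i j hij
    rw [Basis.mk_apply, Basis.mk_apply]
    simp only [v]
    rw [← Module.End.mul_apply, ← pow_succ', show d - 1 - (j : ℕ) + 1 = d - 1 - i by omega]

/-- An operator with at most one-dimensional eigenspaces has a normalized Jordan basis. -/
theorem exists_jordan_basis {E : Type*} [NormedAddCommGroup E] [NormedSpace ℂ E]
    [FiniteDimensional ℂ E] (f : End ℂ E)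
    (hsimple : ∀ (μ : ℂ) (x y : E), f x = μ • x → f y = μ • y → x ≠ 0 → ∃ c : ℂ, y = c • x) :
    ∃ (r : ℕ) (d : Fin r → ℕ) (μ : Fin r → ℂ) (b : Basis (Σ i, Fin (d i)) ℂ E), ∀ i,
      (∀ j : Fin (d i), (j : ℕ) = 0 → f (b ⟨i, j⟩) = μ i • b ⟨i, j⟩ ∧ ‖b ⟨i, j⟩‖ = 1) ∧
      ∀ l j : Fin (d i), (j : ℕ) = l + 1 → f (b ⟨i, j⟩) = μ i • b ⟨i, j⟩ + b ⟨i, l⟩ := by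
  classical
  let r := Fintype.card f.Eigenvalues
  let e : Fin r ≃ f.Eigenvalues := (Fintype.equivFin _).symm
  let μ : Fin r → ℂ := fun i => (e i : ℂ)
  have hμ : Function.Injective μ := fun i j hij => e.injective (Subtype.ext hij)
  let V : Fin r → Submodule ℂ E := fun i => f.maxGenEigenspace (μ i)
  have hV : DirectSum.IsInternal V := by
    refine DirectSum.isInternal_submodule_of_iSupIndep_of_iSup_eq_top
      (f.independent_maxGenEigenspace.comp hμ) ?_
    rw [eq_top_iff, ← End.iSup_maxGenEigenspace_eq_top f]
    refine iSup_le fun ν => ?_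
    by_cases hν : f.HasEigenvalue ν
    · have h1 : μ (e.symm ⟨ν, hν⟩) = ν :=
        congrArg Subtype.val (e.apply_symm_apply ⟨ν, hν⟩)
      exact le_iSup_of_le (e.symm ⟨ν, hν⟩) (by simp only [V, h1, le_refl])
    · have h1 : f.maxGenEigenspace ν = ⊥ := by
        by_contra hne
        exact hν ((End.hasUnifEigenvalue_iff_hasUnifEigenvalue_one (k := ⊤) (by simp)).1 hne)
      rw [h1]
      exact bot_le
  have hchain : ∀ i, ∃ (d : ℕ) (b : Basis (Fin d) ℂ (V i)),
      (∀ j : Fin d, (j : ℕ) = 0 → f (b j) = μ i • (b j : E) ∧ ‖b j‖ = 1) ∧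
      ∀ l j : Fin d, (j : ℕ) = l + 1 → f (b j) = μ i • (b j : E) + b l := by
    intro i
    have hmaps := End.mapsTo_maxGenEigenspace_of_comm
      (Algebra.mul_sub_algebraMap_commutes f (μ i)) (μ i)
    -- The kernel of `N` is an eigenspace, at most a line, so each generalized eigenspace is a
    -- single chain.
    let N : End ℂ (V i) := (f - algebraMap ℂ (End ℂ E) (μ i)).restrict hmaps
    have hN : IsNilpotent N := f.isNilpotent_restrict_maxGenEigenspace_sub_algebraMap (μ i)
    have hNapply : ∀ x : V i, ((N x : V i) : E) = f x - μ i • (x : E) := fun x => rfl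
    have hNiff : ∀ x : V i, N x = 0 → f x = μ i • (x : E) := fun x hx => by
      rw [← sub_eq_zero, ← hNapply, hx, Submodule.coe_zero]
    obtain ⟨d, b, h1, h2⟩ := exists_chain_basis N hN fun x y hx hy hx0 => by
      obtain ⟨c, hc⟩ := hsimple (μ i) x y (hNiff x hx) (hNiff y hy) (by simpa using hx0)
      exact ⟨c, Subtype.ext hc⟩
    refine ⟨d, b, fun j hj => ⟨hNiff _ (h1 j hj).1, (h1 j hj).2⟩, fun l j hl => ?_⟩
    rw [← h2 l j hl, hNapply, add_sub_cancel]
  choose d b h1 h2 using hchain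
  refine ⟨r, d, μ, hV.collectedBasis b, fun i => ?_⟩
  simp only [DirectSum.IsInternal.collectedBasis_coe]
  exact ⟨h1 i, h2 i⟩

/-- A matrix with at most one-dimensional eigenspaces has a normalized Jordan decomposition. -/
theorem exists_isJordanDecomposition {n : ℕ} (B : Matrix (Fin n) (Fin n) ℂ)
    (hsimple : ∀ (μ : ℂ) (v w : Fin n → ℂ), v ≠ 0 → B *ᵥ v = μ • v → B *ᵥ w = μ • w →
      ∃ c : ℂ, w = c • v) :
    ∃ R J : Matrix (Fin n) (Fin n) ℂ, IsJordanDecomposition B R J := by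
  classical
  obtain ⟨r, d, μ, b, hb⟩ := exists_jordan_basis (E := EuclideanSpace ℂ (Fin n))
    (Matrix.toLpLin 2 2 B) fun μ x y hx hy hx0 => by
      obtain ⟨c, hc⟩ := hsimple μ x.ofLp y.ofLp (fun h => hx0 (WithLp.ofLp_injective 2 h))
        (congrArg WithLp.ofLp hx) (congrArg WithLp.ofLp hy)
      exact ⟨c, WithLp.ofLp_injective 2 hc⟩
  have hcard : ∑ i, d i = n := by
    have h1 := Module.finrank_eq_card_basis b
    simpa using h1.symm
  let e : (Σ i, Fin (d i)) ≃ Fin n := finSigmaFinEquiv.trans (finCongr hcard)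
  have he : ∀ (i : Fin r) (l j : Fin (d i)), (j : ℕ) = l + 1 →
      (e ⟨i, j⟩ : ℕ) = e ⟨i, l⟩ + 1 := by
    intro i l j hl
    simp only [e, Equiv.trans_apply, finCongr_apply_coe, finSigmaFinEquiv_apply, hl]
    omega
  let R : Matrix (Fin n) (Fin n) ℂ := Matrix.of fun i j => b (e.symm j) i
  let Js : Matrix (Σ i, Fin (d i)) (Σ i, Fin (d i)) ℂ := Matrix.of fun p q =>
    if p = q then μ p.1 else if p.1 = q.1 ∧ (q.2 : ℕ) = p.2 + 1 then 1 else 0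
  let J : Matrix (Fin n) (Fin n) ℂ := Js.submatrix e.symm e.symm
  have hRcol : ∀ q, R.col (e q) = (b q).ofLp := fun q => by
    funext i
    simp [R]
  have hli : LinearIndependent ℂ R.col := by
    have h1 := (b.linearIndependent.comp e.symm e.symm.injective).map'
      (WithLp.linearEquiv 2 ℂ (Fin n → ℂ)).toLinearMap (LinearEquiv.ker _)
    exact h1
  have hR : IsUnit R := Matrix.linearIndependent_cols_iff_isUnit.1 hli
  have hfirst : ∀ (i : Fin r) (j : Fin (d i)), (j : ℕ) = 0 →
      B *ᵥ R.col (e ⟨i, j⟩) = μ i • R.col (e ⟨i, j⟩) := fun i j hj => by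
    rw [hRcol]
    exact congrArg WithLp.ofLp ((hb i).1 j hj).1
  have hsucc : ∀ (i : Fin r) (l j : Fin (d i)), (j : ℕ) = l + 1 →
      B *ᵥ R.col (e ⟨i, j⟩) = μ i • R.col (e ⟨i, j⟩) + R.col (e ⟨i, l⟩) := fun i l j hl => by
    rw [hRcol, hRcol]
    exact congrArg WithLp.ofLp ((hb i).2 l j hl)
  have hmul : B * R = R * J := by
    have hcol : ∀ q, B *ᵥ R.col (e q) = ∑ p, Js p q • R.col (e p) := by
      rintro ⟨i, j⟩
      by_cases hj : (j : ℕ) = 0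
      · rw [hfirst i j hj, Finset.sum_eq_single ⟨i, j⟩]
        · simp [Js]
        · intro p _ hp
          have : Js p ⟨i, j⟩ = 0 := by
            simp only [Js, Matrix.of_apply]
            rw [if_neg hp, if_neg (by omega)]
          rw [this, zero_smul]
        · simp
      · let l : Fin (d i) := ⟨j - 1, by omega⟩
        have hl : (j : ℕ) = l + 1 := by simp only [l]; omega
        have hne : (⟨i, j⟩ : Σ i, Fin (d i)) ≠ ⟨i, l⟩ := by
          intro h
          rw [Sigma.mk.injEq] at h
          have := eq_of_heq h.2
          rw [← this] at hl
          omega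
        rw [hsucc i l j hl, Finset.sum_eq_add _ _ hne]
        · simp [Js, hne.symm, hl]
        · rintro ⟨i', l'⟩ - ⟨hp1, hp2⟩
          have : Js ⟨i', l'⟩ ⟨i, j⟩ = 0 := by
            simp only [Js, Matrix.of_apply]
            rw [if_neg hp1, if_neg]
            rintro ⟨rfl, h⟩
            have h' : (j : ℕ) = l' + 1 := h
            have hll : l' = l := Fin.ext (by omega)
            exact hp2 (by rw [hll])
          rw [this, zero_smul]
        · simp
        · simp
    ext i j
    have h1 := congrFun (hcol (e.symm j)) i
    rw [Equiv.apply_symm_apply] at h1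
    rw [Matrix.mul_apply, Matrix.mul_apply]
    refine Eq.trans (h1 : ∑ k, B i k * R k j = _) ?_
    rw [Finset.sum_apply, ← Equiv.sum_comp e]
    refine Finset.sum_congr rfl fun p _ => ?_
    simp [J, mul_comm]
  refine ⟨R, J, ⟨?_, ?_⟩, hR, ?_, ?_⟩
  · intro i j hij hij'
    obtain ⟨p, rfl⟩ := e.surjective i
    obtain ⟨q, rfl⟩ := e.surjective j
    simp only [J, Matrix.submatrix_apply, Equiv.symm_apply_apply, Js, Matrix.of_apply]
    rw [if_neg fun h => hij (by rw [h]), if_neg]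
    obtain ⟨i, l⟩ := p
    obtain ⟨i', j⟩ := q
    rintro ⟨rfl, h⟩
    exact hij' (he _ _ _ h)
  · intro i j hij
    have hne : i ≠ j := fun h => by subst h; omega
    simp only [J, Matrix.submatrix_apply, Js, Matrix.of_apply, e.symm.injective.ne_iff.2 hne,
      if_false, if_true]
    split_ifs with h
    · exact Or.inr ⟨rfl, by rw [h.1]⟩
    · exact Or.inl rfl
  · rw [← hmul, Matrix.mul_assoc, Matrix.mul_nonsing_inv _ ((Matrix.isUnit_iff_isUnit_det R).1 hR),
      Matrix.mul_one]
  · intro j ⟨ν, hν⟩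
    obtain ⟨⟨i, j⟩, rfl⟩ := e.surjective j
    by_cases hj : (j : ℕ) = 0
    · rw [hRcol]
      exact ((hb i).1 j hj).2
    -- If a later column of a block were an eigenvector, its predecessor would be a multiple of it.
    · exfalso
      let l : Fin (d i) := ⟨j - 1, by omega⟩
      have hl : (j : ℕ) = l + 1 := by simp only [l]; omega
      have hne := he i l j hl
      rw [hsucc i l j hl] at hν
      refine absurd ?_ (hli.notMem_span_image (s := {e ⟨i, j⟩}) (x := e ⟨i, l⟩) fun h => by
        rw [Set.mem_singleton_iff] at h
        rw [h] at hne
        omega)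
      rw [Set.image_singleton, ← sub_eq_iff_eq_add'.2 hν.symm, ← sub_smul]
      exact Submodule.smul_mem _ _ (Submodule.mem_span_singleton_self _)

end JordanBasis

theorem exists_isJordanFamily {M : ℕ} {D : ℝ} (hD : 0 < D) (h : Fin (M + 1) → ℝ) :
    ∃ R J : ℤ → Matrix (Fin (M + 1)) (Fin (M + 1)) ℂ, IsJordanFamily D h R J := by
  have H : ∀ m : ℤ, ∃ R J : Matrix (Fin (M + 1)) (Fin (M + 1)) ℂ,
      m ≠ 0 → IsJordanDecomposition (modeMatrix D h m) R J := by
    intro m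
    by_cases hm : m = 0
    · exact ⟨0, 0, fun h => absurd hm h⟩
    · obtain ⟨R, J, hRJ⟩ := exists_isJordanDecomposition (modeMatrix D h m)
        fun μ v w hv0 hv hw =>
          exists_eq_smul_of_eigenvector (mode_coeff_ne_zero hD hm) hv hw hv0
      exact ⟨R, J, fun _ => hRJ⟩
  choose R J hRJ using H
  exact ⟨R, J, hRJ⟩

/-! ### Exponentials of Jordan matrices -/

section Exponential

variable {n : ℕ} {B R J : Matrix (Fin n) (Fin n) ℂ}

/-- The nilpotent part of a Jordan matrix. -/
noncomputable def nilpotentPart (J : Matrix (Fin n) (Fin n) ℂ) : Matrix (Fin n) (Fin n) ℂ :=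
  J - Matrix.diagonal J.diag

theorem nilpotentPart_apply_of_ne (hJ : IsJordanNormalForm J) {i j : Fin n}
    (hij : (j : ℕ) ≠ i + 1) : nilpotentPart J i j = 0 := by
  rw [nilpotentPart, Matrix.sub_apply]
  by_cases h : j = i
  · subst h
    simp
  · rw [Matrix.diagonal_apply_ne' _ h, hJ.1 i j h hij, sub_zero]

theorem nilpotentPart_apply_succ {i j : Fin n} (hij : (j : ℕ) = i + 1) :
    nilpotentPart J i j = J i j := by
  have hne : i ≠ j := fun h => by subst h; omega
  rw [nilpotentPart, Matrix.sub_apply, Matrix.diagonal_apply_ne _ hne, sub_zero]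

theorem nilpotentPart_pow_apply_of_ne (hJ : IsJordanNormalForm J) (k : ℕ) :
    ∀ i j : Fin n, (j : ℕ) ≠ i + k → (nilpotentPart J ^ k) i j = 0 := by
  induction k with
  | zero =>
    intro i j hij
    rw [pow_zero, Matrix.one_apply_ne fun h => hij (by rw [h, add_zero])]
  | succ k ih =>
    intro i j hij
    rw [pow_succ, Matrix.mul_apply]
    refine Finset.sum_eq_zero fun l _ => ?_
    by_cases hl : (l : ℕ) = i + k
    · rw [nilpotentPart_apply_of_ne hJ (by omega), mul_zero]
    · rw [ih i l hl, zero_mul]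

theorem nilpotentPart_pow_eq_zero (hJ : IsJordanNormalForm J) {k : ℕ} (hk : n ≤ k) :
    nilpotentPart J ^ k = 0 := by
  ext i j
  exact nilpotentPart_pow_apply_of_ne hJ k i j (by omega)

/-- Each row and column has at most one nonzero entry, a one. So `Nᴴ N` is diagonal with entries `0`
or `1`, and the C⋆-identity applies. -/
theorem norm_nilpotentPart_le_one (hJ : IsJordanNormalForm J) : ‖nilpotentPart J‖ ≤ 1 := by
  have hdiag : (nilpotentPart J)ᴴ * nilpotentPart J =
      Matrix.diagonal ((nilpotentPart J)ᴴ * nilpotentPart J).diag := by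
    ext i j
    by_cases hij : i = j
    · subst hij
      simp
    · rw [Matrix.diagonal_apply_ne _ hij, Matrix.mul_apply]
      refine Finset.sum_eq_zero fun l _ => ?_
      rw [Matrix.conjTranspose_apply]
      by_cases hl : (i : ℕ) = l + 1
      · rw [nilpotentPart_apply_of_ne hJ (j := j) fun h => hij (Fin.ext (by omega)), mul_zero]
      · rw [nilpotentPart_apply_of_ne hJ hl, star_zero, zero_mul]
  have hle : ‖(nilpotentPart J)ᴴ * nilpotentPart J‖ ≤ 1 := by
    rw [hdiag, Matrix.l2_opNorm_diagonal, pi_norm_le_iff_of_nonneg zero_le_one]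
    intro j
    rw [Matrix.diag_apply, Matrix.mul_apply]
    by_cases hj : (j : ℕ) = 0
    · rw [Finset.sum_eq_zero, norm_zero]
      · exact zero_le_one
      · intro l _
        rw [nilpotentPart_apply_of_ne hJ (by omega), mul_zero]
    · let p : Fin n := ⟨j - 1, by omega⟩
      have hp : (j : ℕ) = p + 1 := by simp only [p]; omega
      rw [Finset.sum_eq_single p]
      · rw [Matrix.conjTranspose_apply, nilpotentPart_apply_succ hp]
        rcases hJ.2 p j hp with h | ⟨h, -⟩ <;> simp [h]
      · intro l _ hl
        have hl' : (l : ℕ) ≠ p := fun h => hl (Fin.ext h)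
        rw [nilpotentPart_apply_of_ne hJ (j := j) (by omega), mul_zero]
      · simp
  rw [Matrix.l2_opNorm_conjTranspose_mul_self] at hle
  nlinarith [norm_nonneg (nilpotentPart J)]

/-- The diagonal is constant along each block, and superdiagonal entries between blocks vanish. -/
theorem commute_diagonal_nilpotentPart (hJ : IsJordanNormalForm J) :
    Commute (Matrix.diagonal J.diag) (nilpotentPart J) := by
  ext i j
  rw [Matrix.diagonal_mul, Matrix.mul_diagonal, Matrix.diag_apply, Matrix.diag_apply]
  by_cases hij : (j : ℕ) = i + 1
  · rw [nilpotentPart_apply_succ hij]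
    rcases hJ.2 i j hij with h | ⟨h, hd⟩
    · rw [h, mul_zero, zero_mul]
    · rw [h, hd, mul_comm]
  · rw [nilpotentPart_apply_of_ne hJ hij, mul_zero, zero_mul]

/-- The series stops after `M + 1` terms, each at most `t ^ k ≤ t ^ M + 1`. -/
theorem norm_exp_smul_nilpotentPart_le {M : ℕ} {J : Matrix (Fin (M + 1)) (Fin (M + 1)) ℂ}
    (hJ : IsJordanNormalForm J) {t : ℝ} (ht : 0 < t) :
    ‖NormedSpace.exp (t • nilpotentPart J)‖ ≤ ((M : ℝ) + 1) * (t ^ M + 1) := by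
  have hnorm : ‖t • nilpotentPart J‖ ≤ t := by
    rw [norm_smul, Real.norm_of_nonneg ht.le]
    exact mul_le_of_le_one_right ht.le (norm_nilpotentPart_le_one hJ)
  rw [congrFun (NormedSpace.exp_eq_tsum ℝ) (t • nilpotentPart J),
    tsum_eq_sum (s := Finset.range (M + 1)) fun k hk => by
    rw [smul_pow, nilpotentPart_pow_eq_zero hJ (by simpa using hk), smul_zero, smul_zero]]
  calc _ ≤ ∑ k ∈ Finset.range (M + 1), (t ^ M + 1) := by
        refine norm_sum_le_of_le _ fun k hk => ?_
        have h1 : ‖(t • nilpotentPart J) ^ k‖ ≤ t ^ k :=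
          (norm_pow_le _ _).trans (pow_le_pow_left₀ (norm_nonneg _) hnorm k)
        have h2 : t ^ k ≤ t ^ M + 1 := by
          rcases le_total t 1 with h | h
          · exact (pow_le_one₀ ht.le h).trans (le_add_of_nonneg_left (by positivity))
          · exact (pow_le_pow_right₀ h (Nat.lt_succ_iff.1 (Finset.mem_range.1 hk))).trans
              (le_add_of_nonneg_right zero_le_one)
        rw [norm_smul, norm_inv, Real.norm_natCast]
        refine (mul_le_of_le_one_left (norm_nonneg _) ?_).trans (h1.trans h2)
        exact inv_le_one_of_one_le₀ (by exact_mod_cast k.factorial_pos)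
    _ = _ := by
        rw [Finset.sum_const, Finset.card_range, nsmul_eq_mul, Nat.cast_add, Nat.cast_one]

theorem norm_exp_smul_diagonal_le {d : Fin n → ℂ} {c t : ℝ} (ht : 0 ≤ t)
    (hd : ∀ i, (d i).re ≤ c) :
    ‖NormedSpace.exp (t • Matrix.diagonal d)‖ ≤ Real.exp (c * t) := by
  rw [← Matrix.diagonal_smul, Matrix.exp_diagonal, Matrix.l2_opNorm_diagonal,
    pi_norm_le_iff_of_nonneg (Real.exp_pos _).le]
  intro i
  rw [Pi.coe_exp, ← Complex.exp_eq_exp_ℂ, Complex.norm_exp, Real.exp_le_exp]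
  simpa [mul_comm] using mul_le_mul_of_nonneg_right (hd i) ht

theorem IsJordanDecomposition.diag_mem_spectrum (H : IsJordanDecomposition B R J) (i : Fin n) :
    J i i ∈ spectrum ℂ B := by
  obtain ⟨u, rfl⟩ := H.invertible
  rw [H.eq, ← Matrix.coe_units_inv, spectrum.units_conjugate, spectrum.mem_iff,
    Matrix.isUnit_iff_isUnit_det, Matrix.det_of_isUpperTriangular]
  · rw [isUnit_iff_ne_zero, not_not]
    exact Finset.prod_eq_zero (Finset.mem_univ i) (by simp [Matrix.algebraMap_matrix_apply])
  · intro k l hkl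
    have hlt : (l : ℕ) < k := hkl
    have hne : l ≠ k := fun h => by subst h; omega
    rw [Matrix.sub_apply, H.jordan.1 k l hne (by omega), Matrix.algebraMap_matrix_apply,
      if_neg hne.symm, sub_zero]

theorem IsJordanDecomposition.norm_exp_le {M : ℕ}
    {B R J : Matrix (Fin (M + 1)) (Fin (M + 1)) ℂ} (H : IsJordanDecomposition B R J)
    {C₀ l₀ t : ℝ} (hR : ‖R‖ ≤ C₀) (hR' : ‖R⁻¹‖ ≤ C₀) (hl : ∀ μ ∈ spectrum ℂ B, μ.re < -l₀)
    (ht : 0 < t) :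
    ‖NormedSpace.exp (t • B)‖ ≤ ((M : ℝ) + 1) * C₀ ^ 2 * (t ^ M + 1) * Real.exp (-l₀ * t) := by
  have hJ : t • J = t • Matrix.diagonal J.diag + t • nilpotentPart J := by
    rw [← smul_add, nilpotentPart, add_sub_cancel]
  have hcomm : Commute (t • Matrix.diagonal J.diag) (t • nilpotentPart J) :=
    ((commute_diagonal_nilpotentPart H.jordan).smul_left t).smul_right t
  have hexp : NormedSpace.exp (t • B) = R * NormedSpace.exp (t • J) * R⁻¹ := by
    rw [← Matrix.exp_conj _ _ H.invertible, Matrix.mul_smul, Matrix.smul_mul, ← H.eq]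
  have h1 : ‖NormedSpace.exp (t • J)‖ ≤
      Real.exp (-l₀ * t) * (((M : ℝ) + 1) * (t ^ M + 1)) := by
    rw [hJ, Matrix.exp_add_of_commute _ _ hcomm]
    exact (norm_mul_le _ _).trans (mul_le_mul
      (norm_exp_smul_diagonal_le ht.le fun i => (hl _ (H.diag_mem_spectrum i)).le)
      (norm_exp_smul_nilpotentPart_le H.jordan ht) (norm_nonneg _) (Real.exp_pos _).le)
  have hC : 0 ≤ C₀ := (norm_nonneg _).trans hR
  rw [hexp]
  calc _ ≤ ‖R‖ * ‖NormedSpace.exp (t • J)‖ * ‖R⁻¹‖ :=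
        (norm_mul_le _ _).trans (mul_le_mul_of_nonneg_right (norm_mul_le _ _) (norm_nonneg _))
    _ ≤ C₀ * (Real.exp (-l₀ * t) * (((M : ℝ) + 1) * (t ^ M + 1))) * C₀ := by gcongr
    _ = _ := by ring

/-- Follows from `(l t) ^ M / M! ≤ exp (l t)`; it makes the decay estimate uniform in time. -/
theorem pow_mul_exp_neg_le {l t : ℝ} (hl : 0 < l) (ht : 0 < t) (M : ℕ) :
    (t ^ M + 1) * Real.exp (-l * t) ≤ M.factorial / l ^ M + 1 := by
  have h1 := Real.pow_div_factorial_le_exp (l * t) (by positivity) M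
  have h2 : t ^ M ≤ M.factorial / l ^ M * Real.exp (l * t) := by
    rw [div_le_iff₀ (by positivity), mul_pow] at h1
    rw [div_mul_eq_mul_div, le_div_iff₀ (by positivity)]
    linarith
  have h3 : (1 : ℝ) ≤ Real.exp (l * t) := Real.one_le_exp (by positivity)
  rw [neg_mul, Real.exp_neg, mul_inv_le_iff₀ (Real.exp_pos _)]
  linarith

end Exponential

end HermiteFilter

theorem mainTheorem4 (M : ℕ) (D : ℝ) (hD : 0 < D) (h : Fin (M + 1) → ℝ)
    (h_first : h 0 = 0) (h_nonpos : ∀ i, h i ≤ 0) (h_last : h (Fin.last M) ≠ 0) :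
    -- the exponentials are bounded uniformly in all modes and all positive times
    (∃ C : ℝ, ∀ (m : ℤ) (t : ℝ), 0 < t →
      ‖NormedSpace.exp (t • HermiteFilter.modeMatrix D h m)‖ ≤ C) ∧
    -- the constants exist: normalized Jordan decompositions, a decay rate, a transform bound
    (∃ R J : ℤ → Matrix (Fin (M + 1)) (Fin (M + 1)) ℂ, HermiteFilter.IsJordanFamily D h R J) ∧
    (∃ l₀ : ℝ, HermiteFilter.IsDecayRate D h l₀) ∧
    ∀ R J : ℤ → Matrix (Fin (M + 1)) (Fin (M + 1)) ℂ, HermiteFilter.IsJordanFamily D h R J →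
      (∃ C₀ : ℝ, HermiteFilter.IsTransformBound R C₀) ∧
      -- the decay estimate, with any such constants
      ∀ C₀ l₀ : ℝ, HermiteFilter.IsTransformBound R C₀ → HermiteFilter.IsDecayRate D h l₀ →
        ∀ (m : ℤ) (t : ℝ), m ≠ 0 → 0 < t →
          ‖NormedSpace.exp (t • HermiteFilter.modeMatrix D h m)‖ ≤
            ((M : ℝ) + 1) * C₀ ^ 2 * (t ^ M + 1) * Real.exp (-l₀ * t) := by
  open HermiteFilter in
  have hdecay : ∀ R J : ℤ → Matrix (Fin (M + 1)) (Fin (M + 1)) ℂ, IsJordanFamily D h R J →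
      ∀ C₀ l₀ : ℝ, IsTransformBound R C₀ → IsDecayRate D h l₀ →
        ∀ (m : ℤ) (t : ℝ), m ≠ 0 → 0 < t → ‖NormedSpace.exp (t • modeMatrix D h m)‖ ≤
          ((M : ℝ) + 1) * C₀ ^ 2 * (t ^ M + 1) * Real.exp (-l₀ * t) :=
    fun R J H C₀ l₀ hC hl m t hm ht =>
      (H m hm).norm_exp_le (hC.2 m hm).1 (hC.2 m hm).2 (hl.2 m hm) ht
  obtain ⟨R, J, H⟩ := HermiteFilter.exists_isJordanFamily hD h
  obtain ⟨l₀, hl⟩ := HermiteFilter.exists_isDecayRate hD h_nonpos h_last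
  obtain ⟨C₀, hC⟩ := HermiteFilter.exists_isTransformBound hD H
  refine ⟨?_, ⟨R, J, H⟩, ⟨l₀, hl⟩, fun R J H =>
    ⟨HermiteFilter.exists_isTransformBound hD H, hdecay R J H⟩⟩
  have hl0 := hl.1
  -- The final `+ 1` covers `m = 0`, where the exponential of a nonpositive diagonal matrix has norm
  -- at most `1`.
  refine ⟨((M : ℝ) + 1) * C₀ ^ 2 * (M.factorial / l₀ ^ M + 1) + 1, fun m t ht => ?_⟩
  by_cases hm : m = 0
  · subst hm
    have h1 : HermiteFilter.modeMatrix D h 0 = Matrix.diagonal fun i => (h i : ℂ) := by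
      simp [HermiteFilter.modeMatrix, HermiteFilter.filterMatrix]
    rw [h1]
    refine (HermiteFilter.norm_exp_smul_diagonal_le (c := 0) ht.le fun i => h_nonpos i).trans ?_
    rw [zero_mul, Real.exp_zero]
    exact le_add_of_nonneg_left (by positivity)
  · refine (hdecay R J H C₀ l₀ hC hl m t hm ht).trans ?_
    rw [mul_assoc]
    exact (mul_le_mul_of_nonneg_left (HermiteFilter.pow_mul_exp_neg_le hl0 ht M)
      (by positivity)).trans (le_add_of_nonneg_right zero_le_one)
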